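/- A condensed set (group, ring) is a sheaf of sets (groups, rings) on the site of extremally disconnected compact Hausdorff spaces, with finite jointly surjective families of maps as covers; rings are associative with $1$, not necessarily commutative. For a topological space $X$ write $\underline{X}$ for the condensed set $S\mapsto C(S,X)$. For a condensed ring $\mathcal{R}$ and a condensed group $\mathcal{G}$, the condensed group ring $\mathcal{R}[\mathcal{G}]=\mathcal{R}\otimes\mathbb{Z}[\mathcal{G}]$ is the sheafification of $S\mapsto\mathcal{R}(S)[\mathcal{G}(S)]$. Let $\mathcal{R}$ be a condensed ring, and let $\mathcal{H}\le\mathcal{G}$ be condensed groups, i.e. $\mathcal{H}\to\mathcal{G}$ is a homomorphism of condensed groups such that $\mathcal{H}(S)\to\mathcal{G}(S)$ is injective for every $S$. Suppose that $\mathcal{H}$ is open in $\mathcal{G}$: for every extremally disconnected compact Hausdorff space $S$ and every map of condensed sets $\underline{S}\to\mathcal{G}$, the pullback $\underline{S}\times_{\mathcal{G}}\mathcal{H}$ is represented by an open subset $U$ of $S$ (that is, it is $\underline{U}$, with the projection to $\underline{S}$ induced by the inclusion $U\subseteq S$). Then the restriction functor from condensed $\mathcal{R}[\mathcal{G}]$-modules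 to condensed $\mathcal{R}[\mathcal{H}]$-modules along $\mathcal{R}[\mathcal{H}]\to\mathcal{R}[\mathcal{G}]$ sends projective objects to projective objects, both for left modules and for right modules. -/

import Mathlib

open CategoryTheory Limits Opposite TopologicalSpace

universe u

namespace CondensedModules

/-- Condensed objects of a category `A`: sheaves on the site of extremally disconnected compact
Hausdorff spaces (`Stonean`), where the covers are the finite jointly surjective families; this is
the coherent topology of `Stonean`. As in Mathlib's treatment of condensed mathematics, the spaces
live in universe `u` and the values in universe `u + 1`. -/
abbrev Cond (A : Type*) [Category* A] := Sheaf (coherentTopology Stonean.{u}) A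

/-- Condensed sets. -/
abbrev CondSet := Cond.{u} (Type (u + 1))

/-- Condensed groups. -/
abbrev CondGrp := Cond.{u} GrpCat.{u + 1}

/-- Condensed (associative unital, not necessarily commutative) rings. -/
abbrev CondRing := Cond.{u} RingCat.{u + 1}

/-! ### The condensed set attached to a topological space -/

/-- The condensed set `S ↦ C(S, X)` attached to a topological space `X`. -/
noncomputable def underline (X : Type u) [TopologicalSpace X] : CondSet.{u} where
  obj := ContinuousMap.yonedaPresheaf (CompHausLike.compHausLikeToTop.{u} _) X ⋙
    uliftFunctor.{u + 1}
  property := by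
    rw [Presheaf.isSheaf_iff_preservesFiniteProducts_of_projective]
    have : PreservesFiniteProducts (ContinuousMap.yonedaPresheaf
      (CompHausLike.compHausLikeToTop.{u} (fun X ↦ ExtremallyDisconnected X)) X) := inferInstance
    infer_instance

/-- The map of condensed sets induced by a continuous map: postcomposition with it. -/
noncomputable def underlineMap {X Y : Type u} [TopologicalSpace X] [TopologicalSpace Y]
    (f : C(X, Y)) : underline X ⟶ underline Y where
  hom :=
    { app := fun _ ↦ ↾fun a ↦ ULift.up (f.comp a.down)
      naturality := fun _ _ _ ↦ rfl }

/-! ### Condensed subgroups and openness -/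

/-- The condensed set underlying a condensed group. -/
noncomputable abbrev grpToSet : CondGrp.{u} ⥤ CondSet.{u} :=
  sheafCompose (coherentTopology Stonean.{u}) (forget GrpCat.{u + 1})

/-- `ι : H ⟶ G` makes `H` a condensed subgroup of `G`: each `H(S) → G(S)` is injective. -/
def IsSubgroup {H G : CondGrp.{u}} (ι : H ⟶ G) : Prop :=
  ∀ S : Stonean.{u}, Function.Injective (ι.hom.app (op S)).hom

/-- The condensed subgroup `ι : H ⟶ G` is open: for every `S` and every map of condensed sets
`x : underline S ⟶ G`, the pullback of `ι` along `x` is represented by an open subset `U` of `S`,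
i.e. it is `underline U` with the projection to `underline S` induced by the inclusion of `U`. -/
def IsOpenSubgroup {H G : CondGrp.{u}} (ι : H ⟶ G) : Prop :=
  ∀ (S : Stonean.{u}) (x : underline S ⟶ grpToSet.obj G),
    ∃ (U : Opens S) (y : underline U ⟶ grpToSet.obj H),
      IsPullback (underlineMap ⟨Subtype.val, continuous_subtype_val⟩) y x (grpToSet.map ι)

/-! ### Condensed group rings -/

/-- The presheaf of group rings `S ↦ R(S)[G(S)]`. -/
noncomputable def groupRingPresheaf (R : CondRing.{u}) (G : CondGrp.{u}) :
    Stonean.{u}ᵒᵖ ⥤ RingCat.{u + 1} where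
  obj S := RingCat.of (MonoidAlgebra (R.obj.obj S) (G.obj.obj S))
  map {S T} f := RingCat.ofHom
    ((MonoidAlgebra.mapDomainRingHom (R.obj.obj T) (G.obj.map f).hom).comp
      (MonoidAlgebra.mapRingHom (G.obj.obj S) (R.obj.map f).hom))
  map_id S := by
    ext : 1
    apply MonoidAlgebra.ringHom_ext <;> intros <;> simp
  map_comp f g := by
    ext : 1
    apply MonoidAlgebra.ringHom_ext <;> intros <;> simp

/-- The map of presheaves of group rings induced by a homomorphism of condensed groups. -/
noncomputable def groupRingPresheafMap (R : CondRing.{u}) {H G : CondGrp.{u}} (φ : H ⟶ G) :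
    groupRingPresheaf R H ⟶ groupRingPresheaf R G where
  app S := RingCat.ofHom (MonoidAlgebra.mapDomainRingHom (R.obj.obj S) (φ.hom.app S).hom)
  naturality S T f := by
    have h (a : H.obj.obj S) : (G.obj.map f).hom ((φ.hom.app S).hom a) =
        (φ.hom.app T).hom ((H.obj.map f).hom a) :=
      (ConcreteCategory.congr_hom (φ.hom.naturality f) a).symm
    have key : (MonoidAlgebra.mapDomainRingHom (R.obj.obj T) (φ.hom.app T).hom).comp
          ((MonoidAlgebra.mapDomainRingHom (R.obj.obj T) (H.obj.map f).hom).comp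
            (MonoidAlgebra.mapRingHom (H.obj.obj S) (R.obj.map f).hom)) =
        ((MonoidAlgebra.mapDomainRingHom (R.obj.obj T) (G.obj.map f).hom).comp
          (MonoidAlgebra.mapRingHom (G.obj.obj S) (R.obj.map f).hom)).comp
            (MonoidAlgebra.mapDomainRingHom (R.obj.obj S) (φ.hom.app S).hom) := by
      apply MonoidAlgebra.ringHom_ext <;> intros <;>
        simp only [RingHom.comp_apply, MonoidAlgebra.mapRingHom_single,
          MonoidAlgebra.mapDomainRingHom_apply, MonoidAlgebra.mapDomain_single, map_one, h]
    exact congrArg RingCat.ofHom key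

/-- The condensed group ring `R[G] = R ⊗ ℤ[G]`: the sheafification of `S ↦ R(S)[G(S)]`. -/
noncomputable def groupRing (R : CondRing.{u}) (G : CondGrp.{u}) : CondRing.{u} :=
  (presheafToSheaf (coherentTopology Stonean.{u}) RingCat.{u + 1}).obj (groupRingPresheaf R G)

/-- The map of condensed rings `R[H] ⟶ R[G]` induced by a homomorphism `H ⟶ G`. -/
noncomputable def groupRingMap (R : CondRing.{u}) {H G : CondGrp.{u}} (φ : H ⟶ G) :
    groupRing R H ⟶ groupRing R G :=
  (presheafToSheaf (coherentTopology Stonean.{u}) RingCat.{u + 1}).map (groupRingPresheafMap R φ)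

/-! ### Condensed modules and restriction -/

/-- The functor sending a ring to its opposite ring. -/
def opRing : RingCat.{u} ⥤ RingCat.{u} where
  obj A := RingCat.of (A : Type u)ᵐᵒᵖ
  map f := RingCat.ofHom (RingHom.op f.hom)

instance : opRing.{u + 1}.IsEquivalence :=
  Functor.IsEquivalence.mk' opRing
    (NatIso.ofComponents (fun A ↦ (RingEquiv.opOp A).toRingCatIso) (fun _ ↦ rfl))
    (NatIso.ofComponents (fun A ↦ (RingEquiv.opOp A).symm.toRingCatIso) (fun _ ↦ rfl))

/-- The opposite of a condensed ring, formed pointwise, as a functor. -/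
noncomputable abbrev opCondRing : CondRing.{u} ⥤ CondRing.{u} :=
  sheafCompose (coherentTopology Stonean.{u}) opRing.{u + 1}

/-- Condensed left modules over a condensed ring. -/
abbrev LeftMod (A : CondRing.{u}) := SheafOfModules.{u + 1} A

/-- Condensed right modules over a condensed ring: left modules over the opposite ring. -/
abbrev RightMod (A : CondRing.{u}) := SheafOfModules.{u + 1} (opCondRing.obj A)

/-- Restriction of condensed left modules from `R[G]` to `R[H]`. -/
noncomputable def resLeft (R : CondRing.{u}) {H G : CondGrp.{u}} (ι : H ⟶ G) :
    LeftMod (groupRing R G) ⥤ LeftMod (groupRing R H) :=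
  SheafOfModules.restrictScalars (groupRingMap R ι)

/-- Restriction of condensed right modules from `R[G]` to `R[H]`. -/
noncomputable def resRight (R : CondRing.{u}) {H G : CondGrp.{u}} (ι : H ⟶ G) :
    RightMod (groupRing R G) ⥤ RightMod (groupRing R H) :=
  SheafOfModules.restrictScalars (opCondRing.map (groupRingMap R ι))

end CondensedModules

open CondensedModules

/-! The point is that `R[G]` is free over `R[H]`, section by section and compatibly with
restriction. Let `I = G(*)/H(*)` and regard coset representatives as constant sections of `G`. Given
a section `g` of `G` over `S` and a point `s`, translating `g` by the representative of the coset of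
`g(s)` gives a section whose value at `s` lies in `H`; openness puts it in `H` on a clopen
neighbourhood of `s`. By compactness `G` is locally covered by the cosets of `H`, and these are
disjoint over every nonempty `S` (`exists_cover_rep_mul`, `rep_mul_injective`).

Hence the presheaf `R(S)[G(S)]` is locally a direct sum of copies of `R(S)[H(S)]`. On extremally
disconnected spaces the sheaf condition only asks for preservation of finite products, so a
sectionwise direct sum of sheaves is again a sheaf, and the decomposition passes to the
sheafifications on sections (`bijective_finsuppDesc`). Left cosets give a basis for right modules;
their inverses, right cosets, give one for left modules.

For an extension `A ⟶ B` with such a basis, `X ↦ Hom_{A(X)}(B(X), N(X))` is a sheaf, a product of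
copies of `N`, and serves as coinduction. Epimorphisms of condensed modules are surjective on
sections (`surjective_of_epi`), so coinduction preserves them. A lifting problem for a restricted
projective module thus becomes one over `B`, where it is solvable
(`SheafBasis.preservesProjectiveObjects`). -/

namespace CondensedModules

/-! ### Epimorphisms of sheaves of modules -/

section Epi

universe v v' u' w

variable {C : Type u'} [Category.{v'} C] {J : GrothendieckTopology C}
  {A : Sheaf J RingCat.{w}} [HasSheafify J AddCommGrpCat.{v}]
  [J.WEqualsLocallyBijective AddCommGrpCat.{v}]

/-- An epimorphism of sheaves of modules is locally surjective. -/
lemma isLocallySurjective_of_epi {M N : SheafOfModules.{v} A} (g : M ⟶ N) [Epi g] :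
    PresheafOfModules.IsLocallySurjective J g.val where
  imageSieve_mem {U} s := by
    -- The composite `p` of `N` with the sheafified presheaf cokernel kills `g`, so it vanishes.
    -- Hence the class of `s` in the presheaf cokernel is locally zero, which says that `s` is
    -- locally in the image.
    let π : N.val ⟶ cokernel g.val := cokernel.π g.val
    let adj := PresheafOfModules.sheafificationAdjunction (𝟙 A.obj)
    let η := adj.unit.app (cokernel g.val)
    let p : N ⟶ (PresheafOfModules.sheafification (𝟙 A.obj)).obj (cokernel g.val) :=
      ⟨PresheafOfModules.homMk (((PresheafOfModules.toPresheaf _).map π) ≫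
        (PresheafOfModules.toPresheaf _).map η) fun X r m ↦
          (congr_arg (η.app X) (map_smul (π.app X).hom r m)).trans
            (map_smul (η.app X).hom r (π.app X m))⟩
    have hp : p = 0 := by
      rw [← cancel_epi g, comp_zero]
      apply SheafOfModules.hom_ext
      ext X m
      have h : π.app X (g.val.app X m) = 0 :=
        ConcreteCategory.congr_hom
          (congr_arg (fun p : M.val ⟶ _ ↦ p.app X) (cokernel.condition g.val)) m
      exact (congr_arg (η.app X) h).trans (map_zero (η.app X).hom)
    have hs : η.app _ (π.app _ s) = 0 :=
      DFunLike.congr_fun (F := N.val.obj (op U) →ₗ[A.obj.obj (op U)] _)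
        (congr_arg (fun p ↦ (p.val.app (op U)).hom) hp) s
    have hη : Presheaf.IsLocallyInjective J
        (CategoryTheory.toSheafify J (cokernel g.val).presheaf) := inferInstance
    refine J.superset_covering ?_ (hη.equalizerSieve_mem (X := op U) (π.app _ s) 0
      (hs.trans (map_zero (η.app (op U)).hom).symm))
    intro V f hf
    have hf : (cokernel g.val).map f.op (π.app _ s) = 0 := hf.trans (map_zero _)
    exact (ShortComplex.moduleCat_exact_iff _).1 ((ShortComplex.exact_cokernel g.val).map
      (PresheafOfModules.evaluation _ (op V))) _
        ((PresheafOfModules.naturality_apply π f.op s).trans hf)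

end Epi

/-- An epimorphism of condensed modules is surjective on sections. -/
lemma surjective_of_epi {A : CondRing.{u}} {M N : SheafOfModules.{u + 1} A} (g : M ⟶ N) [Epi g]
    (X : Stonean.{u}ᵒᵖ) : Function.Surjective (g.val.app X) := by
  have h : Sheaf.IsLocallySurjective ((SheafOfModules.toSheaf A).map g) :=
    isLocallySurjective_of_epi g
  rw [coherentTopology.isLocallySurjective_iff, regularTopology.isLocallySurjective_iff] at h
  intro y
  obtain ⟨X', φ, hφ, x, hx⟩ := h X.unop y
  -- Extremally disconnected spaces are projective, so the cover splits and the local preimage pulls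
  -- back along the splitting to a global one.
  let σ : X.unop ⟶ X' := Projective.factorThru (𝟙 _) φ
  have hσ : σ ≫ φ = 𝟙 _ := Projective.factorThru_comp _ _
  refine ⟨M.val.map σ.op x, ?_⟩
  refine (PresheafOfModules.naturality_apply g.val σ.op x).trans ?_
  refine (congr_arg (N.val.map σ.op) hx).trans ?_
  refine (PresheafOfModules.map_comp_apply N.val φ.op σ.op y).symm.trans ?_
  rw [← op_comp, hσ, op_id]
  exact ConcreteCategory.congr_hom (N.val.presheaf.map_id X) y

/-! ### Coinduction along a free extension of sheaves of rings -/

section Coinduction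

universe v' u' t

variable {C : Type u'} [Category.{v'} C] {J : GrothendieckTopology C}
  {A B : Sheaf J RingCat.{max u' v'}} (φ : A ⟶ B)

/-- The sections of `B` over `X`, as a module over the sections of `A`. -/
noncomputable abbrev restrictedSections (X : Cᵒᵖ) : ModuleCat.{max u' v'} (A.obj.obj X) :=
  (ModuleCat.restrictScalars (φ.hom.app X).hom).obj (ModuleCat.of _ (B.obj.obj X))

/-- A basis of `B` over `A`: a basis of the sections over each object, stable under restriction. -/
structure SheafBasis (I : Type t) where
  /-- the basis over each object -/
  basis (X : Cᵒᵖ) : Module.Basis I (A.obj.obj X) (restrictedSections φ X)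
  map_basis {X Y : Cᵒᵖ} (f : X ⟶ Y) (i : I) :
    B.obj.map f (basis X i : B.obj.obj X) = (basis Y i : B.obj.obj Y)

variable {φ} {I : Type t} (β : SheafBasis φ I)

namespace SheafBasis

/-- The restriction of a linear map defined on the sections of `B`, determined by its values on
the basis. -/
noncomputable def restrict (N : SheafOfModules.{max u' v'} A) {X Y : Cᵒᵖ} (f : X ⟶ Y)
    (ψ : restrictedSections φ X →ₗ[A.obj.obj X] N.val.obj X) :
    restrictedSections φ Y →ₗ[A.obj.obj Y] N.val.obj Y :=
  (β.basis Y).constr ℕ fun i ↦ N.val.map f (ψ (β.basis X i))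

lemma restrict_basis (N : SheafOfModules.{max u' v'} A) {X Y : Cᵒᵖ} (f : X ⟶ Y)
    (ψ : restrictedSections φ X →ₗ[A.obj.obj X] N.val.obj X) (i : I) :
    β.restrict N f ψ (β.basis Y i) = N.val.map f (ψ (β.basis X i)) :=
  (β.basis Y).constr_basis _ _ _

/-- Both sides are semilinear in `x` over `A(X) → A(Y)` and agree on the basis. This is needed for
arguments outside the basis: products of sections, and the unit `1`. -/
lemma restrict_map (N : SheafOfModules.{max u' v'} A) {X Y : Cᵒᵖ} (f : X ⟶ Y)
    (ψ : restrictedSections φ X →ₗ[A.obj.obj X] N.val.obj X) (x : B.obj.obj X) :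
    β.restrict N f ψ (B.obj.map f x : B.obj.obj Y) = N.val.map f (ψ x) := by
  have hx : (x : restrictedSections φ X) ∈ Submodule.span _ (Set.range (β.basis X)) :=
    (β.basis X).mem_span x
  induction hx using Submodule.span_induction with
  | mem x hx =>
    obtain ⟨i, rfl⟩ := hx
    rw [β.map_basis]
    exact β.restrict_basis N f ψ i
  | zero =>
    refine (congr_arg (β.restrict N f ψ) (map_zero (B.obj.map f).hom)).trans ?_
    refine (map_zero (β.restrict N f ψ)).trans ?_
    exact ((congr_arg (N.val.map f) (map_zero ψ)).trans (map_zero (N.val.map f).hom)).symm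
  | add x y _ _ hx hy =>
    refine (congr_arg (β.restrict N f ψ) (map_add (B.obj.map f).hom x y)).trans ?_
    refine (map_add (β.restrict N f ψ) _ _).trans ?_
    refine (congr_arg₂ (· + ·) hx hy).trans ?_
    exact ((congr_arg (N.val.map f) (map_add ψ _ _)).trans
      (map_add (N.val.map f).hom _ _)).symm
  | smul a x _ hx =>
    have h : B.obj.map f (φ.hom.app X a * (x : B.obj.obj X)) =
        φ.hom.app Y (A.obj.map f a) * B.obj.map f x :=
      (map_mul (B.obj.map f).hom _ _).trans (congr_arg (· * _)
        (ConcreteCategory.congr_hom (φ.hom.naturality f) a).symm)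
    refine (congr_arg (β.restrict N f ψ) h).trans ?_
    refine ((β.restrict N f ψ).map_smul (A.obj.map f a) _).trans ?_
    refine (congr_arg (A.obj.map f a • ·) hx).trans ?_
    exact ((congr_arg (N.val.map f) (ψ.map_smul a x)).trans (N.val.map_smul f a (ψ x))).symm

lemma restrict_id (N : SheafOfModules.{max u' v'} A) {X : Cᵒᵖ}
    (ψ : restrictedSections φ X →ₗ[A.obj.obj X] N.val.obj X) :
    β.restrict N (𝟙 X) ψ = ψ := by
  refine (β.basis X).ext fun i ↦ ?_
  rw [restrict_basis]
  exact ConcreteCategory.congr_hom (N.val.presheaf.map_id X) _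

lemma restrict_comp (N : SheafOfModules.{max u' v'} A) {X Y Z : Cᵒᵖ} (f : X ⟶ Y) (g : Y ⟶ Z)
    (ψ : restrictedSections φ X →ₗ[A.obj.obj X] N.val.obj X) :
    β.restrict N (f ≫ g) ψ = β.restrict N g (β.restrict N f ψ) := by
  refine (β.basis Z).ext fun i ↦ ?_
  rw [restrict_basis, restrict_basis, restrict_basis]
  exact N.val.map_comp_apply f g _

lemma restrict_add (N : SheafOfModules.{max u' v'} A) {X Y : Cᵒᵖ} (f : X ⟶ Y)
    (ψ ψ' : restrictedSections φ X →ₗ[A.obj.obj X] N.val.obj X) :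
    β.restrict N f (ψ + ψ') = β.restrict N f ψ + β.restrict N f ψ' := by
  refine (β.basis Y).ext fun i ↦ ?_
  rw [LinearMap.add_apply, restrict_basis, restrict_basis, restrict_basis]
  exact map_add (N.val.map f).hom _ _

/-- The coinduced presheaf of abelian groups, `X ↦ Hom_{A(X)}(B(X), N(X))`. -/
noncomputable def coindPresheaf (N : SheafOfModules.{max u' v'} A) : Cᵒᵖ ⥤ Ab.{max u' v'} where
  obj X := AddCommGrpCat.of (restrictedSections φ X →ₗ[A.obj.obj X] N.val.obj X)
  map f := AddCommGrpCat.ofHom (AddMonoidHom.mk' (β.restrict N f) (β.restrict_add N f))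
  map_id _ := ConcreteCategory.hom_ext _ _ fun ψ ↦ β.restrict_id N ψ
  map_comp f g := ConcreteCategory.hom_ext _ _ fun ψ ↦ β.restrict_comp N f g ψ

noncomputable instance (N : SheafOfModules.{max u' v'} A) (X : Cᵒᵖ) :
    Module (B.obj.obj X) ((β.coindPresheaf N).obj X) :=
  ModuleCat.CoextendScalars.isModule (φ.hom.app X).hom (N.val.obj X)

/-- Evaluation on the basis identifies the presheaf with a product of copies of `N`, so one glues
the value at each basis element separately. -/
lemma isSheaf_coindPresheaf (N : SheafOfModules.{max u' v'} A) :
    Presheaf.IsSheaf J (β.coindPresheaf N) := by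
  rw [Presheaf.isSheaf_iff_isSheaf_forget J _ (CategoryTheory.forget _),
    isSheaf_iff_isSheaf_of_type]
  have hN := N.isSheaf
  rw [Presheaf.isSheaf_iff_isSheaf_forget J _ (CategoryTheory.forget _),
    isSheaf_iff_isSheaf_of_type] at hN
  intro X S hS x hx
  let y (i : I) : Presieve.FamilyOfElements (N.val.presheaf ⋙ CategoryTheory.forget _) S.arrows :=
    fun Y f hf ↦
      (show restrictedSections φ (op Y) →ₗ[A.obj.obj (op Y)] N.val.obj (op Y) from x f hf)
        (β.basis (op Y) i)
  have hy (i : I) : (y i).Compatible := by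
    intro Y₁ Y₂ Z g₁ g₂ f₁ f₂ h₁ h₂ fac
    refine (β.restrict_basis N g₁.op _ i).symm.trans ?_
    refine .trans ?_ (β.restrict_basis N g₂.op _ i)
    exact DFunLike.congr_fun (F := restrictedSections φ (op Z) →ₗ[A.obj.obj (op Z)] _)
      (hx g₁ g₂ h₁ h₂ fac) _
  refine ⟨(β.basis (op X)).constr ℕ fun i ↦ (hN S hS).amalgamate (y i) (hy i), ?_, ?_⟩
  · intro Y f hf
    refine (β.basis (op Y)).ext fun i ↦ ?_
    refine (β.restrict_basis N f.op _ i).trans ?_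
    refine (congr_arg (N.val.map f.op) ((β.basis (op X)).constr_basis _ _ _)).trans ?_
    exact (hN S hS).valid_glue (hy i) f hf
  · intro ψ hψ
    refine (β.basis (op X)).ext fun i ↦ ?_
    refine .trans ?_ ((β.basis (op X)).constr_basis _ _ _).symm
    refine (hN S hS).isSeparatedFor.ext fun Y f hf ↦ ?_
    refine .trans ?_ ((hN S hS).valid_glue (hy i) f hf).symm
    refine (β.restrict_basis N f.op _ i).symm.trans ?_
    exact DFunLike.congr_fun (F := restrictedSections φ (op Y) →ₗ[A.obj.obj (op Y)] _)
      (hψ f hf) _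

/-- The coinduced sheaf of modules, `X ↦ Hom_{A(X)}(B(X), N(X))`. -/
noncomputable def coind (N : SheafOfModules.{max u' v'} A) : SheafOfModules.{max u' v'} B where
  val := PresheafOfModules.ofPresheaf (β.coindPresheaf N) fun X Y f b ψ ↦ by
    refine (β.basis Y).ext fun i ↦ ?_
    -- The action is `(b • ψ)(x) = ψ(x * b)`, so the value of `ψ` at a product of a basis element
    -- and `b` has to be restricted.
    refine (β.restrict_basis N f _ i).trans ?_
    refine (β.restrict_map N f ψ ((show B.obj.obj X from β.basis X i) * b)).symm.trans ?_
    refine congr_arg (β.restrict N f ψ) ?_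
    exact (map_mul (B.obj.map f).hom _ _).trans (congr_arg (· * _) (β.map_basis f i))
  isSheaf := β.isSheaf_coindPresheaf N

/-- Coinduction on morphisms: postcomposition. -/
noncomputable def coindMap {N N' : SheafOfModules.{max u' v'} A} (e : N ⟶ N') :
    β.coind N ⟶ β.coind N' where
  val :=
    { app X := (ModuleCat.coextendScalars (φ.hom.app X).hom).map (e.val.app X)
      naturality {X Y} f := by
        ext ψ
        refine (β.basis Y).ext fun i ↦ ?_
        refine .trans ?_ (β.restrict_basis N' f _ i).symm
        refine (congr_arg (e.val.app Y) (β.restrict_basis N f _ i)).trans ?_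
        exact PresheafOfModules.naturality_apply e.val f _ }

/-- By freeness, a lift of a linear map is obtained by lifting its values on the basis
independently. -/
lemma epi_coindMap {N N' : SheafOfModules.{max u' v'} A} (e : N ⟶ N')
    (he : ∀ X, Function.Surjective (e.val.app X)) : Epi (β.coindMap e) := by
  have : Epi (β.coindMap e).val := PresheafOfModules.epi_of_surjective fun X ψ ↦ by
    choose n hn using fun i ↦ he X
      ((show restrictedSections φ X →ₗ[A.obj.obj X] N'.val.obj X from ψ) (β.basis X i))
    refine ⟨(β.basis X).constr ℕ n, (β.basis X).ext fun i ↦ ?_⟩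
    exact (congr_arg (e.val.app X) ((β.basis X).constr_basis _ _ _)).trans (hn i)
  exact (SheafOfModules.forget B).epi_of_epi_map this

/-- The morphism to the coinduced sheaf corresponding to a morphism from a restriction. -/
noncomputable def toCoind {P : SheafOfModules.{max u' v'} B} {N : SheafOfModules.{max u' v'} A}
    (f : (SheafOfModules.restrictScalars φ).obj P ⟶ N) : P ⟶ β.coind N where
  val :=
    { app X := ModuleCat.RestrictionCoextensionAdj.HomEquiv.fromRestriction _ (f.val.app X)
      naturality {X Y} g := by
        ext p
        refine (β.basis Y).ext fun i ↦ ?_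
        refine .trans ?_ (β.restrict_basis N g _ i).symm
        refine .trans ?_ (PresheafOfModules.naturality_apply f.val g _)
        refine congr_arg (f.val.app Y) ?_
        refine .trans ?_ (P.val.map_smul g _ _).symm
        exact congr_arg (fun b : B.obj.obj Y ↦ b • P.val.map g p) (β.map_basis g i).symm }

/-- The morphism from a restriction corresponding to a morphism to the coinduced sheaf. -/
noncomputable def ofCoind {P : SheafOfModules.{max u' v'} B} {N : SheafOfModules.{max u' v'} A}
    (k : P ⟶ β.coind N) : (SheafOfModules.restrictScalars φ).obj P ⟶ N where
  val :=
    { app X := ModuleCat.RestrictionCoextensionAdj.HomEquiv.toRestriction _ (k.val.app X)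
      naturality {X Y} g := by
        ext p
        refine .trans ?_ (β.restrict_map N g _ (1 : B.obj.obj X))
        have h := PresheafOfModules.naturality_apply k.val g p
        refine (DFunLike.congr_fun (F := restrictedSections φ Y →ₗ[A.obj.obj Y] _) h _).trans ?_
        exact congr_arg (β.restrict N g _) (map_one (B.obj.map g).hom).symm }

include β in
/-- Restriction along a free extension of sheaves of rings preserves projective objects, if
epimorphisms of modules over the small ring are surjective on sections. -/
theorem preservesProjectiveObjects
    (hA : ∀ ⦃N N' : SheafOfModules.{max u' v'} A⦄ (e : N ⟶ N') [Epi e] (X : Cᵒᵖ),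
      Function.Surjective (e.val.app X)) :
    (SheafOfModules.restrictScalars.{max u' v'} φ).PreservesProjectiveObjects where
  projective_obj {P} _ := ⟨fun {N N'} f e _ ↦ by
    have := β.epi_coindMap e (hA e)
    -- Evaluating the factorization over `B` at `1` recovers `f`.
    refine ⟨β.ofCoind (Projective.factorThru (β.toCoind f) (β.coindMap e)), ?_⟩
    ext X p
    have h := DFunLike.congr_fun (F := P.val.obj X →ₗ[B.obj.obj X] _)
      (congr_arg (fun p ↦ (p.val.app X).hom)
        (Projective.factorThru_comp (β.toCoind f) (β.coindMap e))) p
    refine (DFunLike.congr_fun (F := restrictedSections φ X →ₗ[A.obj.obj X] _) h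
      (1 : B.obj.obj X)).trans ?_
    exact congr_arg (f.val.app X) (one_smul (B.obj.obj X) (show P.val.obj X from p))⟩

end SheafBasis

end Coinduction

/-! ### Direct sums of copies of an abelian sheaf -/

section Finsupp

universe v' u' w

/-- The functor sending an abelian group `A` to the direct sum of copies of `A` indexed by `I`. -/
noncomputable def finsuppFunctor (I : Type w) : AddCommGrpCat.{w} ⥤ AddCommGrpCat.{w} where
  obj A := AddCommGrpCat.of (I →₀ A)
  map f := AddCommGrpCat.ofHom (Finsupp.mapRange.addMonoidHom f.hom)
  map_id _ := ConcreteCategory.hom_ext _ _ fun x ↦ Finsupp.mapRange_id x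
  map_comp f g := ConcreteCategory.hom_ext _ _ fun x ↦
    Finsupp.mapRange_comp g.hom (map_zero g.hom) f.hom (map_zero f.hom)
      (map_zero (g.hom.comp f.hom)) x

instance (I : Type w) : (finsuppFunctor I).Additive where
  map_add {A B f g} := ConcreteCategory.hom_ext _ _ fun (x : I →₀ A) ↦ by
    refine Finsupp.ext (M := B) fun i ↦ ?_
    exact rfl

variable {C : Type u'} [Category.{v'} C] {I : Type w}

/-- The morphism from a direct sum of copies of an abelian presheaf determined by a family of
morphisms. -/
noncomputable def finsuppDesc {A B : Cᵒᵖ ⥤ AddCommGrpCat.{w}} (τ : I → (A ⟶ B)) :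
    A ⋙ finsuppFunctor I ⟶ B where
  app X := AddCommGrpCat.ofHom (Finsupp.liftAddHom fun i ↦ ((τ i).app X).hom)
  naturality X Y f := by
    refine AddCommGrpCat.hom_ext (Finsupp.addHom_ext fun i a ↦ ?_)
    refine (congr_arg (Finsupp.liftAddHom fun i ↦ ((τ i).app Y).hom)
      (Finsupp.mapRange_single (hf := map_zero (A.map f).hom))).trans ?_
    refine (Finsupp.liftAddHom_apply_single _ _ _).trans ?_
    refine (ConcreteCategory.congr_hom ((τ i).naturality f) a).trans ?_
    exact congr_arg (B.map f)
      (Finsupp.liftAddHom_apply_single (fun i ↦ ((τ i).app X).hom) i a).symm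

lemma finsuppDesc_single {A B : Cᵒᵖ ⥤ AddCommGrpCat.{w}} (τ : I → (A ⟶ B)) (X : Cᵒᵖ) (i : I)
    (a : A.obj X) : (finsuppDesc τ).app X (Finsupp.single i a) = (τ i).app X a :=
  Finsupp.liftAddHom_apply_single _ _ _

variable (J : GrothendieckTopology C) {A₀ A : Cᵒᵖ ⥤ AddCommGrpCat.{w}} (η : A₀ ⟶ A)

instance [Presheaf.IsLocallyInjective J η] :
    Presheaf.IsLocallyInjective J (Functor.whiskerRight η (finsuppFunctor I)) where
  equalizerSieve_mem {X} (x y : I →₀ A₀.obj X) h := by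
    classical
    have hi (i : I) : η.app X (x i) = η.app X (y i) := DFunLike.congr_fun (F := I →₀ A.obj X) h i
    -- Only finitely many coordinates are nonzero, so finitely many covering sieves are intersected.
    refine J.superset_covering ?_ (Finset.inf_induction (s := x.support ∪ y.support)
      (f := fun i ↦ Presheaf.equalizerSieve (F := A₀) (x i) (y i)) (p := (· ∈ J X.unop))
      (J.top_mem _) (fun _ h _ h' ↦ J.intersection_covering h h')
      fun i _ ↦ Presheaf.equalizerSieve_mem J η _ _ (hi i))
    intro Y f hf
    refine Finsupp.ext (M := A₀.obj (op Y)) fun i ↦ ?_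
    change A₀.map f.op (x i) = A₀.map f.op (y i)
    by_cases hi : i ∈ x.support ∪ y.support
    · exact Finset.inf_le (f := fun i ↦ Presheaf.equalizerSieve (F := A₀) (x i) (y i)) hi _ hf
    · rw [Finset.mem_union, not_or, Finsupp.notMem_support_iff, Finsupp.notMem_support_iff] at hi
      rw [hi.1, hi.2]

lemma imageSieve_mem_add {F G : Cᵒᵖ ⥤ AddCommGrpCat.{w}} (T : F ⟶ G) {X : C} (x y : G.obj (op X))
    (hx : Presheaf.imageSieve T x ∈ J X) (hy : Presheaf.imageSieve T y ∈ J X) :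
    Presheaf.imageSieve T (x + y) ∈ J X := by
  refine J.superset_covering ?_ (J.intersection_covering hx hy)
  rintro Y f ⟨⟨a, ha⟩, ⟨b, hb⟩⟩
  refine ⟨(a + b : F.obj (op Y)), ?_⟩
  refine (map_add (T.app (op Y)).hom a b).trans ?_
  refine (congr_arg₂ (· + ·) ha hb).trans ?_
  exact (map_add (G.map f.op).hom x y).symm

lemma imageSieve_mem_zero {F G : Cᵒᵖ ⥤ AddCommGrpCat.{w}} (T : F ⟶ G) (X : C) :
    Presheaf.imageSieve T (0 : G.obj (op X)) ∈ J X := by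
  refine J.superset_covering ?_ (J.top_mem X)
  intro Y f _
  exact ⟨(0 : F.obj (op Y)), (map_zero (T.app (op Y)).hom).trans (map_zero (G.map f.op).hom).symm⟩

instance [Presheaf.IsLocallySurjective J η] :
    Presheaf.IsLocallySurjective J (Functor.whiskerRight η (finsuppFunctor I)) where
  imageSieve_mem {X} (x : I →₀ A.obj (op X)) := by
    induction x using Finsupp.induction_linear with
    | zero => exact imageSieve_mem_zero J (Functor.whiskerRight η (finsuppFunctor I)) X
    | add x y hx hy =>
      exact imageSieve_mem_add J (Functor.whiskerRight η (finsuppFunctor I)) x y hx hy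
    | single i a =>
      refine J.superset_covering ?_ (Presheaf.imageSieve_mem J η a)
      rintro Y f ⟨b, hb⟩
      refine ⟨Finsupp.single (M := A₀.obj (op Y)) i b, ?_⟩
      refine (Finsupp.mapRange_single (hf := map_zero (η.app (op Y)).hom)).trans ?_
      refine (congr_arg (Finsupp.single (M := A.obj (op Y)) i) hb).trans ?_
      exact (Finsupp.mapRange_single (hf := map_zero (A.map f.op).hom)).symm

end Finsupp

/-- A family of morphisms of condensed abelian groups identifies its target with a direct sum of
copies of its source, if it is so locally before sheafification. -/
lemma bijective_finsuppDesc {I : Type (u + 1)} {A₀ B₀ : Stonean.{u}ᵒᵖ ⥤ AddCommGrpCat.{u + 1}}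
    {A B : Cond.{u} AddCommGrpCat.{u + 1}} (η : A₀ ⟶ A.obj) (θ : B₀ ⟶ B.obj)
    [Presheaf.IsLocallyInjective (coherentTopology Stonean.{u}) η]
    [Presheaf.IsLocallySurjective (coherentTopology Stonean.{u}) η]
    [Presheaf.IsLocallyInjective (coherentTopology Stonean.{u}) θ]
    [Presheaf.IsLocallySurjective (coherentTopology Stonean.{u}) θ]
    (τ₀ : I → (A₀ ⟶ B₀)) (τ : I → (A.obj ⟶ B.obj)) (h : ∀ i, η ≫ τ i = τ₀ i ≫ θ)
    [Presheaf.IsLocallyInjective (coherentTopology Stonean.{u}) (finsuppDesc τ₀)]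
    [Presheaf.IsLocallySurjective (coherentTopology Stonean.{u}) (finsuppDesc τ₀)]
    (X : Stonean.{u}ᵒᵖ) : Function.Bijective ((finsuppDesc τ).app X) := by
  have fac : Functor.whiskerRight η (finsuppFunctor I) ≫ finsuppDesc τ = finsuppDesc τ₀ ≫ θ := by
    ext X : 2
    refine AddCommGrpCat.hom_ext (Finsupp.addHom_ext fun i a ↦ ?_)
    refine (congr_arg ((finsuppDesc τ).app X)
      (Finsupp.mapRange_single (hf := map_zero (η.app X).hom))).trans ?_
    refine (finsuppDesc_single τ X i _).trans ?_
    refine (ConcreteCategory.congr_hom (NatTrans.congr_app (h i) X) a).trans ?_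
    exact congr_arg (θ.app X) (finsuppDesc_single τ₀ X i a).symm
  -- No sheafification is needed: an additive functor preserves finite products, hence the sheaf
  -- condition on this site.
  let F : Cond.{u} AddCommGrpCat.{u + 1} := ⟨A.obj ⋙ finsuppFunctor I,
    have := Functor.preservesFiniteProductsOfAdditive (finsuppFunctor I)
    Presheaf.isSheaf_coherent_of_projective_comp _ _ A.property⟩
  let T : F ⟶ B := ⟨finsuppDesc τ⟩
  have h₁ : Sheaf.IsLocallyInjective T :=
    Presheaf.isLocallyInjective_of_isLocallyInjective_of_isLocallySurjective_fac _ _ fac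
  have h₂ : Sheaf.IsLocallySurjective T :=
    Presheaf.isLocallySurjective_of_isLocallySurjective_fac _ fac
  have : IsIso T := (Sheaf.isLocallyBijective_iff_isIso T).1 ⟨h₁, h₂⟩
  have : IsIso T.hom := inferInstanceAs (IsIso ((sheafToPresheaf _ _).map T))
  exact ConcreteCategory.bijective_of_isIso (T.hom.app X)

/-! ### Group rings and decompositions of condensed groups -/

/-- The empty family covers the empty space. This disposes of the one case in which the pieces of a
`Decomposition` need not be disjoint. -/
lemma mem_coherentTopology_of_isEmpty {X : Stonean.{u}} [IsEmpty X] (S : Sieve X) :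
    S ∈ coherentTopology Stonean.{u} X := by
  rw [coherentTopology.mem_sieves_iff_hasEffectiveEpiFamily]
  exact ⟨Empty, inferInstance, Empty.elim, fun a ↦ a.elim,
    Stonean.effectiveEpiFamily_of_jointly_surjective _ _ fun b ↦ isEmptyElim b, fun a ↦ a.elim⟩

section

variable {C : Type*} [Category* C] (J : GrothendieckTopology C) {P Q : Cᵒᵖ ⥤ RingCat} (f : P ⟶ Q)

instance [Presheaf.IsLocallyInjective J f] :
    Presheaf.IsLocallyInjective J (Functor.whiskerRight f (forget₂ RingCat AddCommGrpCat)) where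
  equalizerSieve_mem x y h := Presheaf.equalizerSieve_mem J f x y h

instance [Presheaf.IsLocallySurjective J f] :
    Presheaf.IsLocallySurjective J (Functor.whiskerRight f (forget₂ RingCat AddCommGrpCat)) where
  imageSieve_mem x := Presheaf.imageSieve_mem J f x

end

/-- A family of maps exhibiting the condensed set underlying `G` as a disjoint union of copies of
the one underlying `H`. -/
structure Decomposition (H G : CondGrp.{u}) (I : Type (u + 1)) where
  /-- the inclusions of the pieces -/
  map (S : Stonean.{u}ᵒᵖ) (i : I) (h : H.obj.obj S) : G.obj.obj S
  map_restrict {S T : Stonean.{u}ᵒᵖ} (f : S ⟶ T) (i : I) (h : H.obj.obj S) :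
    G.obj.map f (map S i h) = map T i (H.obj.map f h)
  injective (S : Stonean.{u}) [Nonempty S] ⦃i j : I⦄ ⦃h h' : H.obj.obj (op S)⦄ :
    map _ i h = map _ j h' → i = j ∧ h = h'
  exists_cover (S : Stonean.{u}) (g : G.obj.obj (op S)) :
    ∃ K ∈ coherentTopology Stonean.{u} S, ∀ ⦃T : Stonean.{u}⦄ (f : T ⟶ S), K f →
      ∃ i h, map (op T) i h = G.obj.map f.op g

/-- The presheaf of abelian groups underlying the presheaf of group rings. -/
noncomputable abbrev groupRingPresheafAb (R : CondRing.{u}) (G : CondGrp.{u}) :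
    Stonean.{u}ᵒᵖ ⥤ AddCommGrpCat.{u + 1} :=
  groupRingPresheaf R G ⋙ forget₂ RingCat AddCommGrpCat

/-- The sheaf of abelian groups underlying the condensed group ring. -/
noncomputable abbrev groupRingAb (R : CondRing.{u}) (G : CondGrp.{u}) :
    Cond.{u} AddCommGrpCat.{u + 1} :=
  (sheafCompose _ (forget₂ RingCat AddCommGrpCat)).obj (groupRing R G)

/-- The canonical map from the presheaf of group rings to the condensed group ring. -/
noncomputable def toGroupRing (R : CondRing.{u}) (G : CondGrp.{u}) :
    groupRingPresheaf R G ⟶ (groupRing R G).obj :=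
  CategoryTheory.toSheafify (coherentTopology Stonean.{u}) (groupRingPresheaf R G)

instance (R : CondRing.{u}) (G : CondGrp.{u}) :
    Presheaf.IsLocallyInjective (coherentTopology Stonean.{u}) (toGroupRing R G) :=
  inferInstanceAs (Presheaf.IsLocallyInjective _ (CategoryTheory.toSheafify _ _))

instance (R : CondRing.{u}) (G : CondGrp.{u}) :
    Presheaf.IsLocallySurjective (coherentTopology Stonean.{u}) (toGroupRing R G) :=
  inferInstanceAs (Presheaf.IsLocallySurjective _ (CategoryTheory.toSheafify _ _))

/-- The map of abelian presheaves underlying `toGroupRing`. -/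
noncomputable abbrev toGroupRingAb (R : CondRing.{u}) (G : CondGrp.{u}) :
    groupRingPresheafAb R G ⟶ (groupRingAb R G).obj :=
  Functor.whiskerRight (toGroupRing R G) (forget₂ RingCat AddCommGrpCat)

instance (R : CondRing.{u}) (G : CondGrp.{u}) :
    Presheaf.IsLocallyInjective (coherentTopology Stonean.{u}) (toGroupRingAb R G) :=
  inferInstanceAs (Presheaf.IsLocallyInjective _
    (Functor.whiskerRight (toGroupRing R G) (forget₂ RingCat AddCommGrpCat)))

instance (R : CondRing.{u}) (G : CondGrp.{u}) :
    Presheaf.IsLocallySurjective (coherentTopology Stonean.{u}) (toGroupRingAb R G) :=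
  inferInstanceAs (Presheaf.IsLocallySurjective _
    (Functor.whiskerRight (toGroupRing R G) (forget₂ RingCat AddCommGrpCat)))

lemma groupRingPresheaf_map_single (R : CondRing.{u}) (G : CondGrp.{u})
    {S T : Stonean.{u}ᵒᵖ} (f : S ⟶ T) (g : G.obj.obj S) (r : R.obj.obj S) :
    (groupRingPresheaf R G).map f (MonoidAlgebra.single g r) =
      MonoidAlgebra.single (G.obj.map f g) (R.obj.map f r) :=
  (congr_arg (MonoidAlgebra.mapDomain _) (MonoidAlgebra.mapRingHom_single _ _ _)).trans
    MonoidAlgebra.mapDomain_single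

namespace Decomposition

variable {H G : CondGrp.{u}} {I : Type (u + 1)} (D : Decomposition H G I) (R : CondRing.{u})

/-- The map of presheaves of group rings induced by the inclusion of a piece. -/
noncomputable def ringMap (i : I) : groupRingPresheafAb R H ⟶ groupRingPresheafAb R G where
  app S := AddCommGrpCat.ofHom (AddMonoidHom.mk' (MonoidAlgebra.mapDomain (D.map S i))
    (MonoidAlgebra.mapDomain_add _))
  naturality S T f := by
    refine AddCommGrpCat.hom_ext (MonoidAlgebra.addMonoidHom_ext fun h r ↦ ?_)
    refine (congr_arg (MonoidAlgebra.mapDomain (D.map T i))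
      (groupRingPresheaf_map_single R H f h r)).trans ?_
    refine MonoidAlgebra.mapDomain_single.trans ?_
    rw [← D.map_restrict, ← groupRingPresheaf_map_single]
    exact congr_arg ((groupRingPresheaf R G).map f) MonoidAlgebra.mapDomain_single.symm

/-- Disjointness of the pieces lets each coefficient be read off from the sum, which yields
injectivity over nonempty `S`. -/
lemma coeff_finsuppDesc_ringMap (S : Stonean.{u}) [Nonempty S]
    (a : I →₀ MonoidAlgebra (R.obj.obj (op S)) (H.obj.obj (op S))) (i : I)
    (h : H.obj.obj (op S)) :
    MonoidAlgebra.coeff (R := R.obj.obj (op S)) (M := G.obj.obj (op S))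
      ((finsuppDesc (D.ringMap R)).app (op S) a) (D.map (op S) i h) = (a i).coeff h := by
  classical
  induction a using Finsupp.induction_linear with
  | zero =>
    refine (congr_arg (fun x : MonoidAlgebra (R.obj.obj (op S)) (G.obj.obj (op S)) ↦ x.coeff _)
      (map_zero ((finsuppDesc (D.ringMap R)).app (op S)).hom)).trans rfl
  | add a b ha hb =>
    refine (congr_arg (fun x : MonoidAlgebra (R.obj.obj (op S)) (G.obj.obj (op S)) ↦ x.coeff _)
      (map_add ((finsuppDesc (D.ringMap R)).app (op S)).hom a b)).trans ?_
    exact congr_arg₂ (· + ·) ha hb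
  | single j r =>
    refine (congr_arg (fun x : MonoidAlgebra (R.obj.obj (op S)) (G.obj.obj (op S)) ↦ x.coeff _)
      (finsuppDesc_single (D.ringMap R) (op S) j r)).trans ?_
    change Finsupp.mapDomain (D.map (op S) j) r.coeff (D.map (op S) i h) = _
    by_cases hj : j = i
    · subst hj
      rw [Finsupp.mapDomain_apply fun _ _ e ↦ (D.injective S e).2, Finsupp.single_eq_same]
    · rw [Finsupp.mapDomain_of_notMem_range, Finsupp.single_eq_of_ne' hj]
      · rfl
      · rintro ⟨h', e⟩
        exact hj (D.injective S e).1

instance : Presheaf.IsLocallyInjective (coherentTopology Stonean.{u})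
    (finsuppDesc (D.ringMap R)) where
  equalizerSieve_mem {S} (x y : I →₀ MonoidAlgebra (R.obj.obj S) (H.obj.obj S)) e := by
    obtain hS | hS := isEmpty_or_nonempty S.unop
    · exact mem_coherentTopology_of_isEmpty _
    · have : x = y := Finsupp.ext fun i ↦ MonoidAlgebra.ext (Finsupp.ext fun h ↦ by
        have hx := D.coeff_finsuppDesc_ringMap R S.unop x i h
        have hy := D.coeff_finsuppDesc_ringMap R S.unop y i h
        rw [← hx, ← hy]
        exact congr_arg (fun x : MonoidAlgebra (R.obj.obj S) (G.obj.obj S) ↦ x.coeff _) e)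
      subst this
      refine (coherentTopology Stonean.{u}).superset_covering ?_ (GrothendieckTopology.top_mem _ _)
      intro T f _
      rfl

instance : Presheaf.IsLocallySurjective (coherentTopology Stonean.{u})
    (finsuppDesc (D.ringMap R)) where
  imageSieve_mem {S} (x : MonoidAlgebra (R.obj.obj (op S)) (G.obj.obj (op S))) := by
    induction x using MonoidAlgebra.induction_linear with
    | zero => exact imageSieve_mem_zero _ (finsuppDesc (D.ringMap R)) S
    | add x y hx hy => exact imageSieve_mem_add _ (finsuppDesc (D.ringMap R)) x y hx hy
    | single g r =>
      obtain ⟨K, hK, hD⟩ := D.exists_cover S g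
      refine (coherentTopology Stonean.{u}).superset_covering ?_ hK
      intro T f hf
      obtain ⟨i, h, e⟩ := hD f hf
      refine ⟨Finsupp.single (M := MonoidAlgebra (R.obj.obj (op T)) (H.obj.obj (op T))) i
        (MonoidAlgebra.single h (R.obj.map f.op r)), ?_⟩
      refine (finsuppDesc_single (D.ringMap R) (op T) i _).trans ?_
      refine MonoidAlgebra.mapDomain_single.trans ?_
      rw [e]
      exact (groupRingPresheaf_map_single R G f.op g r).symm

/-- Morphisms between the condensed group rings extending those induced by the inclusions of the
pieces of a decomposition exhibit the target as a direct sum of copies of the source. -/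
lemma bijective (τ : I → ((groupRingAb R H).obj ⟶ (groupRingAb R G).obj))
    (hτ : ∀ i, toGroupRingAb R H ≫ τ i = D.ringMap R i ≫ toGroupRingAb R G)
    (S : Stonean.{u}ᵒᵖ) : Function.Bijective ((finsuppDesc τ).app S) :=
  bijective_finsuppDesc (toGroupRingAb R H) (toGroupRingAb R G) (D.ringMap R) τ hτ S

end Decomposition

/-! ### Coset decomposition with respect to an open condensed subgroup -/

lemma extremallyDisconnected_of_isOpen {X : Type*} [TopologicalSpace X] [ExtremallyDisconnected X]
    {V : Set X} (hV : IsOpen V) : ExtremallyDisconnected V where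
  open_closure W hW := by
    rw [Topology.IsInducing.subtypeVal.closure_eq_preimage_closure_image]
    exact (ExtremallyDisconnected.open_closure _ (hV.isOpenMap_subtype_val W hW)).preimage
      continuous_subtype_val

/-- The one-point space. -/
abbrev point : Stonean.{u} := Stonean.of PUnit.{u + 1}

/-- The map from the one-point space with a given value. -/
noncomputable abbrev pointMap {S : Stonean.{u}} (s : S) : point ⟶ S :=
  CompHausLike.ofHom _ (ContinuousMap.const _ s)

/-- The map to the one-point space. -/
noncomputable abbrev toPoint (S : Stonean.{u}) : S ⟶ point :=
  CompHausLike.ofHom _ (ContinuousMap.const _ PUnit.unit)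

/-- The map of condensed sets corresponding to a section of a condensed group. -/
noncomputable def ofSection {G : CondGrp.{u}} {S : Stonean.{u}} (x : G.obj.obj (op S)) :
    underline S ⟶ grpToSet.obj G where
  hom :=
    { app T := ↾fun a ↦ G.obj.map (CompHausLike.ofHom _ a.down : T.unop ⟶ S).op x
      naturality T T' f := by
        ext a
        exact ConcreteCategory.congr_hom
          (G.obj.map_comp (CompHausLike.ofHom _ a.down : T.unop ⟶ S).op f) x }

/-- A section of `G` whose value at a point lies in an open subgroup lies in the subgroup in a
neighbourhood of the point. -/
lemma exists_isOpen_range {G H : CondGrp.{u}} {ι : H ⟶ G} (hopen : IsOpenSubgroup ι)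
    {S : Stonean.{u}} (x : G.obj.obj (op S)) (s : S)
    (hs : ∃ h, ι.hom.app (op point) h = G.obj.map (pointMap s).op x) :
    ∃ (V : Stonean.{u}) (f : V ⟶ S), IsOpen (Set.range f) ∧ s ∈ Set.range f ∧
      ∃ h, ι.hom.app (op V) h = G.obj.map f.op x := by
  obtain ⟨U, y, sq⟩ := hopen S (ofSection x)
  have sq' (T : Stonean.{u}ᵒᵖ) := sq.map (sheafToPresheaf _ _ ⋙ (evaluation _ _).obj T)
  obtain ⟨h, hh⟩ := hs
  -- On points, the pullback property says that `s` lies in `U` as soon as the value of `x` at `s`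
  -- comes from `H`.
  obtain ⟨p, hp, -⟩ := Types.exists_of_isPullback (sq' (op point))
    (ULift.up (ContinuousMap.const _ s)) h hh.symm
  have hsU : s ∈ U := by
    let q : U := (show ULift.{u + 1} C(PUnit.{u + 1}, U) from p).down PUnit.unit
    have hq : (q : S) = s :=
      congr_arg (fun a : ULift.{u + 1} C(PUnit.{u + 1}, S) ↦ a.down PUnit.unit) hp
    exact hq ▸ q.2
  -- `U` need not be compact; a clopen neighbourhood inside it is an object of the site.
  obtain ⟨V, hV, hsV, hVU⟩ := compact_exists_isClopen_in_isOpen U.isOpen hsU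
  have : CompactSpace V := isCompact_iff_compactSpace.1 hV.isClosed.isCompact
  have : ExtremallyDisconnected V := extremallyDisconnected_of_isOpen hV.isOpen
  let f : Stonean.of V ⟶ S := CompHausLike.ofHom _ ⟨Subtype.val, continuous_subtype_val⟩
  have hf : Set.range f = V := Subtype.range_val
  refine ⟨Stonean.of V, f, by rw [hf]; exact hV.isOpen, by rw [hf]; exact hsV, ?_⟩
  let b : C(V, U) := ⟨Set.inclusion hVU, continuous_inclusion hVU⟩
  let b' : (underline U).obj.obj (op (Stonean.of V)) := ULift.up b
  exact ⟨y.hom.app (op (Stonean.of V)) b',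
    (ConcreteCategory.congr_hom (sq' (op (Stonean.of V))).w b').symm⟩

lemma mem_coherentTopology_of_forall_exists {S : Stonean.{u}} (K : Sieve S)
    (h : ∀ s : S, ∃ (V : Stonean.{u}) (f : V ⟶ S), IsOpen (Set.range f) ∧ s ∈ Set.range f ∧ K f) :
    K ∈ coherentTopology Stonean.{u} S := by
  choose V f hopen hmem hK using h
  obtain ⟨t, ht⟩ := isCompact_univ.elim_finite_subcover (fun s : S ↦ Set.range (f s)) hopen
    fun s _ ↦ Set.mem_iUnion.2 ⟨s, hmem s⟩
  rw [coherentTopology.mem_sieves_iff_hasEffectiveEpiFamily]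
  refine ⟨Fin t.card, inferInstance, fun i ↦ V (t.equivFin.symm i), fun i ↦ f (t.equivFin.symm i),
    Stonean.effectiveEpiFamily_of_jointly_surjective _ _ fun b ↦ ?_, fun i ↦ hK _⟩
  obtain ⟨s, hs, x, hx⟩ := Set.mem_iUnion₂.1 (ht (Set.mem_univ b))
  refine ⟨t.equivFin ⟨s, hs⟩, ?_⟩
  rw [Equiv.symm_apply_apply]
  exact ⟨x, hx⟩

section Cosets

variable {G H : CondGrp.{u}} (ι : H ⟶ G)

/-- The left cosets of the points of `H` in the points of `G`. -/
abbrev Cosets : Type (u + 1) :=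
  G.obj.obj (op point) ⧸ (ι.hom.app (op point)).hom.range

/-- A coset representative, as a constant section. -/
noncomputable def rep (i : Cosets ι) (S : Stonean.{u}ᵒᵖ) : G.obj.obj S :=
  G.obj.map (toPoint S.unop).op (Quotient.out i : G.obj.obj (op point))

lemma map_rep (i : Cosets ι) {S T : Stonean.{u}ᵒᵖ} (f : S ⟶ T) :
    G.obj.map f (rep ι i S) = rep ι i T :=
  (ConcreteCategory.congr_hom (G.obj.map_comp (toPoint S.unop).op f) _).symm

lemma map_app {S T : Stonean.{u}ᵒᵖ} (f : S ⟶ T) (h : H.obj.obj S) :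
    G.obj.map f (ι.hom.app S h) = ι.hom.app T (H.obj.map f h) :=
  (ConcreteCategory.congr_hom (ι.hom.naturality f) h).symm

lemma rep_point (i : Cosets ι) : (rep ι i (op point) : Cosets ι) = i := by
  have : toPoint.{u} point = 𝟙 point := rfl
  refine .trans ?_ (Quotient.out_eq i)
  exact congr_arg QuotientGroup.mk (ConcreteCategory.congr_hom
    ((congr_arg (fun f ↦ G.obj.map (Quiver.Hom.op f)) this).trans (G.obj.map_id _)) _)

variable {ι}

/-- Restricting to a point of `S` compares cosets in `G(*)/H(*)` and gives `i = j`; cancelling the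
representative leaves injectivity of `ι`. -/
lemma rep_mul_injective (hsub : IsSubgroup ι) (S : Stonean.{u}) [Nonempty S] {i j : Cosets ι}
    {h h' : H.obj.obj (op S)}
    (e : rep ι i (op S) * ι.hom.app (op S) h = rep ι j (op S) * ι.hom.app (op S) h') :
    i = j ∧ h = h' := by
  obtain ⟨s⟩ := ‹Nonempty S›
  have hij : i = j := by
    have e' := congr_arg (G.obj.map (pointMap s).op) e
    rw [map_mul, map_mul, map_rep, map_rep, map_app, map_app] at e'
    rw [← rep_point ι i, ← rep_point ι j]
    have e'' := congr_arg (QuotientGroup.mk (s := (ι.hom.app (op point)).hom.range)) e'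
    rwa [QuotientGroup.mk_mul_of_mem _ (MonoidHom.mem_range.2 ⟨_, rfl⟩),
      QuotientGroup.mk_mul_of_mem _ (MonoidHom.mem_range.2 ⟨_, rfl⟩)] at e''
  subst hij
  exact ⟨rfl, hsub S (mul_left_cancel e)⟩

lemma exists_cover_rep_mul (hopen : IsOpenSubgroup ι) (S : Stonean.{u}) (g : G.obj.obj (op S)) :
    ∃ K ∈ coherentTopology Stonean.{u} S, ∀ ⦃T : Stonean.{u}⦄ (f : T ⟶ S), K f →
      ∃ i h, rep ι i (op T) * ι.hom.app (op T) h = G.obj.map f.op g := by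
  let K : Sieve S :=
    { arrows T f := ∃ i h, rep ι i (op T) * ι.hom.app (op T) h = G.obj.map f.op g
      downward_closed := by
        rintro T T' f ⟨i, h, e⟩ f'
        refine ⟨i, H.obj.map f'.op h, ?_⟩
        rw [op_comp, G.obj.map_comp, ConcreteCategory.comp_apply, ← e, map_mul, map_rep, map_app] }
  refine ⟨K, mem_coherentTopology_of_forall_exists K fun s ↦ ?_, fun T f hf ↦ hf⟩
  -- Near `s` the relevant coset is that of the value `g(s)`.
  let i : Cosets ι := QuotientGroup.mk (G.obj.map (pointMap s).op g)
  have hi : (rep ι i (op point) : Cosets ι) = QuotientGroup.mk (G.obj.map (pointMap s).op g) :=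
    rep_point ι i
  obtain ⟨h, hh⟩ := QuotientGroup.eq.1 hi
  obtain ⟨V, f, hV, hs, h', e⟩ := exists_isOpen_range hopen ((rep ι i (op S))⁻¹ * g) s
    ⟨h, by rw [map_mul, map_inv, map_rep]; exact hh⟩
  refine ⟨V, f, hV, hs, i, h', ?_⟩
  rw [e, map_mul, map_inv, map_rep, mul_inv_cancel_left]

/-- The decomposition of `G` into left cosets of an open subgroup. -/
noncomputable def leftCosets (hsub : IsSubgroup ι) (hopen : IsOpenSubgroup ι) :
    Decomposition H G (Cosets ι) where
  map S i h := rep ι i S * ι.hom.app S h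
  map_restrict f i h := by rw [map_mul, map_rep, map_app]
  injective S _ _ _ _ _ e := rep_mul_injective hsub S e
  exists_cover := exists_cover_rep_mul hopen

/-- The decomposition of `G` into right cosets of an open subgroup. -/
noncomputable def rightCosets (hsub : IsSubgroup ι) (hopen : IsOpenSubgroup ι) :
    Decomposition H G (Cosets ι) where
  map S i h := ι.hom.app S h * (rep ι i S)⁻¹
  map_restrict f i h := by rw [map_mul, map_inv, map_rep, map_app]
  injective S _ i j h h' e := by
    -- Inversion exchanges right and left cosets.
    have e' := congr_arg (·⁻¹) e
    simp only [mul_inv_rev, inv_inv, ← map_inv] at e'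
    obtain ⟨h₁, h₂⟩ := rep_mul_injective hsub S e'
    exact ⟨h₁, inv_injective h₂⟩
  exists_cover S g := by
    obtain ⟨K, hK, hg⟩ := exists_cover_rep_mul hopen S g⁻¹
    refine ⟨K, hK, fun T f hf ↦ ?_⟩
    obtain ⟨i, h, e⟩ := hg f hf
    refine ⟨i, h⁻¹, ?_⟩
    rw [map_inv, ← mul_inv_rev, e, map_inv, inv_inv]

end Cosets

/-! ### Condensed group rings are free over those of open subgroups -/

section Bases

variable {A B : CondRing.{u}} {φ : A ⟶ B} {I : Type (u + 1)}

/-- The basis of a module determined by the bijectivity of the associated map. -/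
noncomputable def basisOfBijective {K M : Type*} [Ring K] [AddCommGroup M] [Module K M] {I : Type*}
    (v : I → M) (hv : Function.Bijective (Finsupp.linearCombination K v)) : Module.Basis I K M :=
  .ofRepr (LinearEquiv.ofBijective _ hv).symm

lemma basisOfBijective_apply {K M : Type*} [Ring K] [AddCommGroup M] [Module K M] {I : Type*}
    (v : I → M) (hv : Function.Bijective (Finsupp.linearCombination K v)) (i : I) :
    basisOfBijective v hv i = v i := by
  refine (Finsupp.linearCombination_single K (1 : K) i).trans ?_
  rw [one_smul]

/-- A basis of `B` as a left module over `A`. -/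
noncomputable def SheafBasis.ofBijectiveLeft (b : I → ∀ X, B.obj.obj X)
    (hb : ∀ i {X Y : Stonean.{u}ᵒᵖ} (f : X ⟶ Y), B.obj.map f (b i X) = b i Y)
    (h : ∀ X, Function.Bijective
      fun a : I →₀ A.obj.obj X ↦ a.sum fun i r ↦ φ.hom.app X r * b i X) :
    SheafBasis φ I where
  basis X := basisOfBijective (M := restrictedSections φ X) (fun i ↦ b i X) (h X)
  map_basis {X Y} f i :=
    (congr_arg (B.obj.map f) (basisOfBijective_apply (M := restrictedSections φ X) _ (h X) i)).trans
      ((hb i f).trans (basisOfBijective_apply (M := restrictedSections φ Y) _ (h Y) i).symm)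

/-- A basis of `B` as a right module over `A`. -/
noncomputable def SheafBasis.ofBijectiveRight (b : I → ∀ X, B.obj.obj X)
    (hb : ∀ i {X Y : Stonean.{u}ᵒᵖ} (f : X ⟶ Y), B.obj.map f (b i X) = b i Y)
    (h : ∀ X, Function.Bijective
      fun a : I →₀ A.obj.obj X ↦ a.sum fun i r ↦ b i X * φ.hom.app X r) :
    SheafBasis (opCondRing.map φ) I :=
  .ofBijectiveLeft (fun i X ↦ MulOpposite.op (b i X))
    (fun i _ _ f ↦ congr_arg MulOpposite.op (hb i f)) fun X ↦ by
    -- Passing to opposites on coefficients and on values turns `b i * r` into left multiplication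
    -- by `r`, so bijectivity transfers.
    let e := Finsupp.mapRange.addEquiv (ι := I) (MulOpposite.opAddEquiv (α := A.obj.obj X))
    have key : (fun a : I →₀ (A.obj.obj X)ᵐᵒᵖ ↦ a.sum fun i r ↦
        MulOpposite.op (φ.hom.app X r.unop) * MulOpposite.op (b i X)) ∘ e =
        MulOpposite.opAddEquiv ∘
          fun a : I →₀ A.obj.obj X ↦ a.sum fun i r ↦ b i X * φ.hom.app X r := by
      funext a
      refine .trans ?_ (map_finsuppSum (MulOpposite.opAddEquiv (α := B.obj.obj X)) a
        fun i r ↦ b i X * φ.hom.app X r).symm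
      refine Finsupp.sum_mapRange_index (f := MulOpposite.op) (hf := rfl) (g := a)
        (h := fun i r ↦ MulOpposite.op (φ.hom.app X r.unop) * MulOpposite.op (b i X)) fun i ↦ ?_
      exact (congr_arg (· * MulOpposite.op (b i X))
        (congr_arg MulOpposite.op (map_zero (φ.hom.app X).hom))).trans (zero_mul _)
    have := (MulOpposite.opAddEquiv (α := B.obj.obj X)).bijective.comp (h X)
    rw [← key] at this
    exact (Function.Bijective.of_comp_iff _ e.bijective).1 this

end Bases

section Multiplication

variable {A B : CondRing.{u}} (φ : A ⟶ B) (b : ∀ X, B.obj.obj X)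
  (hb : ∀ {X Y : Stonean.{u}ᵒᵖ} (f : X ⟶ Y), B.obj.map f (b X) = b Y)

/-- A morphism of condensed rings followed by right multiplication with a global section. -/
noncomputable def compMulRight :
    A.obj ⋙ forget₂ RingCat AddCommGrpCat ⟶ B.obj ⋙ forget₂ RingCat AddCommGrpCat where
  app X := AddCommGrpCat.ofHom ((AddMonoidHom.mulRight (b X)).comp
    (φ.hom.app X).hom.toAddMonoidHom)
  naturality X Y f := ConcreteCategory.hom_ext _ _ fun a ↦ by
    change φ.hom.app Y (A.obj.map f a) * b Y = B.obj.map f (φ.hom.app X a * b X)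
    rw [map_mul, hb]
    exact congr_arg (· * b Y) (ConcreteCategory.congr_hom (φ.hom.naturality f) a)

/-- A morphism of condensed rings followed by left multiplication with a global section. -/
noncomputable def compMulLeft :
    A.obj ⋙ forget₂ RingCat AddCommGrpCat ⟶ B.obj ⋙ forget₂ RingCat AddCommGrpCat where
  app X := AddCommGrpCat.ofHom ((AddMonoidHom.mulLeft (b X)).comp
    (φ.hom.app X).hom.toAddMonoidHom)
  naturality X Y f := ConcreteCategory.hom_ext _ _ fun a ↦ by
    change b Y * φ.hom.app Y (A.obj.map f a) = B.obj.map f (b X * φ.hom.app X a)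
    rw [map_mul, hb]
    exact congr_arg (b Y * ·) (ConcreteCategory.congr_hom (φ.hom.naturality f) a)

end Multiplication

section GroupRing

variable (R : CondRing.{u}) {G H : CondGrp.{u}} {ι : H ⟶ G}

/-- The section of the condensed group ring given by a section of the group. -/
noncomputable def groupElement {S : Stonean.{u}ᵒᵖ} (g : G.obj.obj S) : (groupRing R G).obj.obj S :=
  (toGroupRing R G).app S
    (MonoidAlgebra.single g 1 : MonoidAlgebra (R.obj.obj S) (G.obj.obj S))

lemma map_groupElement {S T : Stonean.{u}ᵒᵖ} (f : S ⟶ T) (g : G.obj.obj S) :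
    (groupRing R G).obj.map f (groupElement R g) = groupElement R (G.obj.map f g) := by
  refine (ConcreteCategory.congr_hom ((toGroupRing R G).naturality f) _).symm.trans ?_
  refine congr_arg ((toGroupRing R G).app T) ((groupRingPresheaf_map_single R G f g 1).trans ?_)
  rw [map_one]

lemma groupRingMap_toGroupRing (S : Stonean.{u}ᵒᵖ)
    (a : MonoidAlgebra (R.obj.obj S) (H.obj.obj S)) :
    (groupRingMap R ι).hom.app S ((toGroupRing R H).app S a) =
      (toGroupRing R G).app S (MonoidAlgebra.mapDomain (ι.hom.app S) a) :=
  (ConcreteCategory.congr_hom (NatTrans.congr_app (toSheafify_naturality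
    (coherentTopology Stonean.{u}) (groupRingPresheafMap R ι)) S) a).symm

lemma mapDomain_mul_single {K M N : Type*} [Semiring K] [Mul N] (f : M → N) (n : N)
    (a : MonoidAlgebra K M) :
    MonoidAlgebra.mapDomain f a * MonoidAlgebra.single n 1 =
      MonoidAlgebra.mapDomain (fun m ↦ f m * n) a := by
  induction a using MonoidAlgebra.induction_linear with
  | zero => simp
  | add a b ha hb => simp only [MonoidAlgebra.mapDomain_add, add_mul, ha, hb]
  | single m r => simp

lemma single_mul_mapDomain {K M N : Type*} [Semiring K] [Mul N] (f : M → N) (n : N)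
    (a : MonoidAlgebra K M) :
    MonoidAlgebra.single n 1 * MonoidAlgebra.mapDomain f a =
      MonoidAlgebra.mapDomain (fun m ↦ n * f m) a := by
  induction a using MonoidAlgebra.induction_linear with
  | zero => simp
  | add a b ha hb => simp only [MonoidAlgebra.mapDomain_add, mul_add, ha, hb]
  | single m r => simp

/-- Coset representatives of an open subgroup form a basis of the condensed group ring as a left
module. -/
noncomputable def groupRingBasisLeft (hsub : IsSubgroup ι) (hopen : IsOpenSubgroup ι) :
    SheafBasis (groupRingMap R ι) (Cosets ι) :=
  .ofBijectiveLeft (fun i X ↦ groupElement R (rep ι i X)⁻¹)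
    (fun i _ _ f ↦ by rw [map_groupElement, map_inv, map_rep])
    -- Left `R[H]`-combinations of the inverse representatives correspond to the cosets `H * (rep
    -- i)⁻¹`; compatibility is checked on presheaf group rings.
    ((rightCosets hsub hopen).bijective R
      (fun i ↦ compMulRight (groupRingMap R ι) (fun X ↦ groupElement R (rep ι i X)⁻¹)
        fun f ↦ by rw [map_groupElement, map_inv, map_rep])
      fun i ↦ by
        ext S : 2
        refine ConcreteCategory.hom_ext _ _ fun a ↦ ?_
        refine (congr_arg (· * groupElement R (rep ι i S)⁻¹)
          (groupRingMap_toGroupRing R S a)).trans ?_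
        refine (map_mul ((toGroupRing R G).app S).hom _ _).symm.trans ?_
        exact congr_arg ((toGroupRing R G).app S) (mapDomain_mul_single _ _ a))

/-- Coset representatives of an open subgroup form a basis of the condensed group ring as a right
module. -/
noncomputable def groupRingBasisRight (hsub : IsSubgroup ι) (hopen : IsOpenSubgroup ι) :
    SheafBasis (opCondRing.map (groupRingMap R ι)) (Cosets ι) :=
  .ofBijectiveRight (fun i X ↦ groupElement R (rep ι i X))
    (fun i _ _ f ↦ by rw [map_groupElement, map_rep])
    ((leftCosets hsub hopen).bijective R
      (fun i ↦ compMulLeft (groupRingMap R ι) (fun X ↦ groupElement R (rep ι i X))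
        fun f ↦ by rw [map_groupElement, map_rep])
      fun i ↦ by
        ext S : 2
        refine ConcreteCategory.hom_ext _ _ fun a ↦ ?_
        refine (congr_arg (groupElement R (rep ι i S) * ·)
          (groupRingMap_toGroupRing R S a)).trans ?_
        refine (map_mul ((toGroupRing R G).app S).hom _ _).symm.trans ?_
        exact congr_arg ((toGroupRing R G).app S) (single_mul_mapDomain _ _ a))

end GroupRing

end CondensedModules

theorem mainTheorem4 (R : CondRing.{u}) (G H : CondGrp.{u}) (ι : H ⟶ G)
    (hsub : IsSubgroup ι) (hopen : IsOpenSubgroup ι) :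
    (resLeft R ι).PreservesProjectiveObjects ∧ (resRight R ι).PreservesProjectiveObjects :=
  ⟨(groupRingBasisLeft R hsub hopen).preservesProjectiveObjects fun _ _ e _ ↦ surjective_of_epi e,
    (groupRingBasisRight R hsub hopen).preservesProjectiveObjects
      fun _ _ e _ ↦ surjective_of_epi e⟩
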